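/- Let $\alpha\in(2,\infty)\setminus\mathbb Z$ and let $l:\mathbb R\to\mathbb R$ be slowly varying, i.e. $\lim_{x\to\infty} l(\lambda x)/l(x)=1$ for every $\lambda>0$. Let $H\ge 0$ be a random variable with $\mathbb P(H>h)=h^{1-\alpha}\,l(h)$ for all $h\ge 1$, and let $\mu=\mathbb E(H)$. In the Chung–Lu random graph on the vertices $1,\dots,n$, the vertices have independent weights $H_1,\dots,H_n$ distributed as $H$, and conditionally on the weights each pair $\{i,j\}$ of distinct vertices is joined by an edge, independently of the other pairs, with probability $\min\{H_iH_j/(\mu n),1\}$. Let $k\ge 2$ be a fixed integer and, for $n\ge k$, let $\mathbb P(K_k)$ be the probability that $k$ given vertices (for instance $1,\dots,k$) form a clique. Then, as $n\to\infty$, $$\mathbb P(K_k)\asymp\begin{cases} n^{\frac k2(1-k)} & \text{when } k<\alpha,\\ n^{\frac k2(1-\alpha)}\,l(\sqrt n)^k & \text{when } k>\alpha.\end{cases}$$ Here $f(n)\asymp g(n)$ means that there are constants $n_0\ge 0$ and $0<C_1<C_2<\infty$ such that $C_1g(n)\le f(n)\le C_2g(n)$ for all $n>n_0$. -/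

import Mathlib

open MeasureTheory ProbabilityTheory Filter Topology
open scoped NNReal unitInterval

/-- Slowly varying at infinity, in the sense of Karamata: `l (c x) / l x → 1` as `x → ∞`, for every
`c > 0`. -/
def SlowlyVarying (l : ℝ → ℝ) : Prop :=
  ∀ c : ℝ, 0 < c → Tendsto (fun x : ℝ => l (c * x) / l x) atTop (𝓝 1)

/-- `f n ≍ g n`: the two sequences agree up to constant factors for all large `n`. -/
def SameOrder (f g : ℕ → ℝ) : Prop :=
  ∃ (n₀ : ℕ) (C₁ C₂ : ℝ), 0 < C₁ ∧ C₁ < C₂ ∧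
    ∀ n : ℕ, n₀ < n → C₁ * g n ≤ f n ∧ f n ≤ C₂ * g n

namespace ChungLu

noncomputable section

/-- The mean `μ = 𝔼 H` of the weight distribution `ν` (the law of the nonnegative weight `H`). -/
def mean (ν : Measure ℝ≥0) : ℝ := ∫ x : ℝ≥0, (x : ℝ) ∂ν

theorem mean_nonneg (ν : Measure ℝ≥0) : 0 ≤ mean ν :=
  integral_nonneg fun x => x.2

/-- The probability `min {x y / (μ n), 1}` that two vertices of weights `x` and `y` are joined. -/
def edgeProb (ν : Measure ℝ≥0) (n : ℕ) (x y : ℝ≥0) : I :=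
  ⟨min ((x : ℝ) * (y : ℝ) / (mean ν * (n : ℝ))) 1,
    le_min (div_nonneg (mul_nonneg x.2 y.2) (mul_nonneg (mean_nonneg ν) n.cast_nonneg)) zero_le_one,
    min_le_right _ _⟩

theorem edgeProb_comm (ν : Measure ℝ≥0) (n : ℕ) (x y : ℝ≥0) :
    edgeProb ν n x y = edgeProb ν n y x := by
  simp [edgeProb, mul_comm (x : ℝ)]

theorem measurable_edgeProb (ν : Measure ℝ≥0) (n : ℕ) :
    Measurable fun z : ℝ≥0 × ℝ≥0 => edgeProb ν n z.1 z.2 := by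
  unfold edgeProb
  exact Measurable.subtype_mk (by fun_prop)

/-- The probability of the pair `e` of vertices being joined, given the vector `h` of weights. -/
def pairProb (ν : Measure ℝ≥0) (n : ℕ) (h : Fin n → ℝ≥0) (e : Sym2 (Fin n)) : I :=
  Sym2.lift ⟨fun i j => edgeProb ν n (h i) (h j), fun _ _ => edgeProb_comm ν n _ _⟩ e

theorem measurable_pairProb (ν : Measure ℝ≥0) (n : ℕ) (e : Sym2 (Fin n)) :
    Measurable fun h : Fin n → ℝ≥0 => pairProb ν n h e := by
  induction e with
  | h i j =>
    have hij : Measurable fun h : Fin n → ℝ≥0 => (h i, h j) := by fun_prop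
    exact (measurable_edgeProb ν n).comp hij

/-- Independent coin flips, one for each pair `e` of vertices, which show `True` with the
probability `pairProb ν n h e`. -/
def coinLaw (ν : Measure ℝ≥0) (n : ℕ) (h : Fin n → ℝ≥0) : Measure (Sym2 (Fin n) → Prop) :=
  Measure.pi fun e => bernoulliMeasure True False (pairProb ν n h e)

/-- The conditional law of the random graph given the vector `h` of weights: the edges are present
independently of each other, the edge `{i, j}` with probability `min {h i * h j / (μ n), 1}`.
(The coins of the degenerate pairs `{i, i}` are ignored by `SimpleGraph.fromEdgeSet`.) -/
def graphLawGiven (ν : Measure ℝ≥0) (n : ℕ) (h : Fin n → ℝ≥0) : Measure (SimpleGraph (Fin n)) :=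
  (coinLaw ν n h).map fun b => SimpleGraph.fromEdgeSet {e | b e}

instance (ν : Measure ℝ≥0) (n : ℕ) (h : Fin n → ℝ≥0) : IsProbabilityMeasure (coinLaw ν n h) := by
  unfold coinLaw; infer_instance

theorem measurable_coinLaw (ν : Measure ℝ≥0) (n : ℕ) : Measurable (coinLaw ν n) := by
  classical
  refine Measure.measurable_of_measurable_coe _ fun S _ => ?_
  have key : ∀ h : Fin n → ℝ≥0, coinLaw ν n h S =
      ∑ b ∈ S.toFinite.toFinset, ∏ e, bernoulliMeasure True False (pairProb ν n h e) {b e} := by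
    intro h
    have h1 := sum_measure_singleton (μ := coinLaw ν n h) (s := S.toFinite.toFinset)
    rw [Set.Finite.coe_toFinset] at h1
    rw [← h1]
    refine Finset.sum_congr rfl fun b _ => ?_
    rw [coinLaw, Measure.pi_singleton]
  simp_rw [key]
  refine Finset.measurable_sum _ fun b _ => Finset.measurable_prod _ fun e _ => ?_
  have hp := measurable_pairProb ν n e
  simp only [bernoulliMeasure_def, Measure.add_apply, Measure.smul_apply]
  refine Measurable.add ?_ ?_
  · exact Measurable.smul_const (by fun_prop) _
  · exact Measurable.smul_const (by fun_prop) _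

theorem measurable_graphLawGiven (ν : Measure ℝ≥0) (n : ℕ) : Measurable (graphLawGiven ν n) :=
  (Measure.measurable_map _ (measurable_of_finite _)).comp (measurable_coinLaw ν n)

/-- The law of the Chung-Lu random graph with `n` vertices and weight distribution `ν`: the weights
of the vertices are independent with law ν, and given the weights `h` the graph has the law
`graphLawGiven ν n h`. -/
def graphLaw (ν : Measure ℝ≥0) (n : ℕ) : Measure (SimpleGraph (Fin n)) :=
  (Measure.pi fun _ : Fin n => ν).bind (graphLawGiven ν n)

/-- The probability that the vertices of `s` form a clique in the Chung-Lu random graph. -/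
def cliqueProb (ν : Measure ℝ≥0) (n : ℕ) (s : Finset (Fin n)) : ℝ :=
  (graphLaw ν n).real {G | G.IsClique (s : Set (Fin n))}

end

end ChungLu

/-! Put `β = α - 1` and `xᵢ = Hᵢ / √(μ n)`. Given the weights, the vertices of `s` form a clique
with probability `∏ min (xᵢ xⱼ) 1` over the pairs. If such a product is dominated by a product of
functions of the single `xᵢ`, independence turns the bound into the `k`-th power of one integral.

For `k < α`, dropping the truncation gives `∏ xᵢ ^ (k - 1)`, and the moment of order `k - 1 < β` is
finite. For `k > α`, the key is an inequality in `tᵢ = log xᵢ`: since `0 < β < k - 1`, the sum of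
`min (tᵢ + tⱼ) 0` over the pairs is at most `β ∑ tᵢ - c ∑ |tᵢ|` for some `c > 0`
(`exists_sum_pairs_min_le`). The gain `c` makes the integral converge at both ends against a tail of
index `-β`, so it is of the order of the tail at `√(μ n)` (`RegularTail.exists_lintegral_le`).

The lower bounds keep only weights above 1, respectively above `√(μ n)`, where every edge is
certain. Regular variation replaces `√(μ n)` by `√n`. -/

open scoped ENNReal in
theorem lintegral_pi_prod_eq_prod_lintegral {ι Ω : Type*} [Fintype ι] [MeasurableSpace Ω]
    (ν : Measure Ω) [IsProbabilityMeasure ν] (s : Finset ι) {f : Ω → ℝ≥0∞} (hf : Measurable f) :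
    ∫⁻ h, ∏ i ∈ s, f (h i) ∂(Measure.pi fun _ : ι => ν) = (∫⁻ x, f x ∂ν) ^ s.card := by
  have hind : iIndepFun (fun (i : ι) (h : ι → Ω) => f (h i)) (Measure.pi fun _ : ι => ν) :=
    iIndepFun_pi (X := fun _ : ι => f) fun _ => hf.aemeasurable
  rw [lintegral_prod_eq_prod_lintegral_of_indepFun s _ hind
    fun i => hf.comp (measurable_pi_apply i)]
  have (i : ι) : ∫⁻ h, f (h i) ∂(Measure.pi fun _ : ι => ν) = ∫⁻ x, f x ∂ν :=
    (measurePreserving_eval (fun _ : ι => ν) i).lintegral_comp hf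
  simp [this]

/-! ### Clique probabilities as integrals over the weights -/

namespace ChungLu

open scoped ENNReal

/-- The pairs of distinct elements of `s`. -/
def pairs {ι : Type*} [DecidableEq ι] (s : Finset ι) : Finset (Sym2 ι) :=
  {e ∈ s.sym2 | ¬ e.IsDiag}

theorem isClique_fromEdgeSet_iff {ι : Type*} [DecidableEq ι] (s : Finset ι) (E : Set (Sym2 ι)) :
    (SimpleGraph.fromEdgeSet E).IsClique (s : Set ι) ↔ ∀ e ∈ pairs s, e ∈ E := by
  constructor
  · intro h e he
    induction e with
    | h i j =>
      simp only [pairs, Finset.mem_filter, Finset.mk_mem_sym2_iff, Sym2.mk_isDiag_iff] at he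
      exact ((SimpleGraph.fromEdgeSet_adj E).1 (h he.1.1 he.1.2 he.2)).1
  · intro h i hi j hj hij
    refine (SimpleGraph.fromEdgeSet_adj E).2 ⟨h _ ?_, hij⟩
    simp only [pairs, Finset.mem_filter, Finset.mk_mem_sym2_iff, Sym2.mk_isDiag_iff]
    exact ⟨⟨hi, hj⟩, hij⟩

theorem measurableSet_isClique {n : ℕ} (s : Finset (Fin n)) :
    MeasurableSet {G : SimpleGraph (Fin n) | G.IsClique (s : Set (Fin n))} := by
  have hadj (i j : Fin n) : MeasurableSet {G : SimpleGraph (Fin n) | G.Adj i j} :=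
    measurableSet_setOfPred.2 (SimpleGraph.measurable_iff_adj.1 measurable_id i j)
  have heq : {G : SimpleGraph (Fin n) | G.IsClique (s : Set (Fin n))} =
      ⋂ i ∈ s, ⋂ j ∈ s, ⋂ _ : i ≠ j, {G : SimpleGraph (Fin n) | G.Adj i j} := by
    ext G
    simp [SimpleGraph.isClique_iff, Set.Pairwise]
  rw [heq]
  exact s.measurableSet_biInter fun i _ => s.measurableSet_biInter fun j _ =>
    MeasurableSet.iInter fun _ => hadj i j

/-- The clique event is a box in the space of coins: `True` is forced on the pairs inside `s`, and
the other coordinates are free and contribute a factor 1. -/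
theorem graphLawGiven_isClique (ν : Measure ℝ≥0) (n : ℕ) (h : Fin n → ℝ≥0) (s : Finset (Fin n)) :
    graphLawGiven ν n h {G | G.IsClique (s : Set (Fin n))} =
      ∏ e ∈ pairs s, ENNReal.ofReal (pairProb ν n h e) := by
  classical
  rw [graphLawGiven, Measure.map_apply (measurable_of_finite _) (measurableSet_isClique s)]
  have hset : (fun b : Sym2 (Fin n) → Prop => SimpleGraph.fromEdgeSet {e | b e}) ⁻¹'
      {G | G.IsClique (s : Set (Fin n))} =
      Set.univ.pi fun e => if e ∈ pairs s then {True} else Set.univ := by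
    ext b
    simp only [Set.mem_preimage, Set.mem_ofPred_eq, isClique_fromEdgeSet_iff, Set.mem_pi,
      Set.mem_univ, true_imp_iff]
    refine forall_congr' fun e => ?_
    by_cases he : e ∈ pairs s <;> simp [he]
  rw [hset, coinLaw, Measure.pi_pi, ← Finset.prod_subset (Finset.subset_univ (pairs s))]
  · refine Finset.prod_congr rfl fun e he => ?_
    rw [if_pos he, bernoulliMeasure_apply _ (Set.toFinite _).measurableSet]
    simp only [Set.mem_singleton_iff, if_true, eq_iff_iff, iff_true, if_false]
    rw [ENNReal.ofReal, Real.toNNReal_of_nonneg (pairProb ν n h e).2.1]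
    rfl
  · intro e _ he
    rw [if_neg he, measure_univ]

theorem ofReal_cliqueProb (ν : Measure ℝ≥0) [IsProbabilityMeasure ν] (n : ℕ)
    (s : Finset (Fin n)) :
    ENNReal.ofReal (cliqueProb ν n s) =
      ∫⁻ h, ∏ e ∈ pairs s, ENNReal.ofReal (pairProb ν n h e) ∂(Measure.pi fun _ : Fin n => ν) := by
  have hG : graphLaw ν n {G | G.IsClique (s : Set (Fin n))} =
      ∫⁻ h, ∏ e ∈ pairs s, ENNReal.ofReal (pairProb ν n h e) ∂(Measure.pi fun _ : Fin n => ν) := by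
    rw [graphLaw, Measure.bind_apply (measurableSet_isClique s)
      (measurable_graphLawGiven ν n).aemeasurable]
    exact lintegral_congr fun h => graphLawGiven_isClique ν n h s
  rw [cliqueProb, measureReal_def, ENNReal.ofReal_toReal, hG]
  rw [hG]
  refine ne_of_lt (lt_of_le_of_lt (lintegral_mono (g := fun _ => 1) fun h => ?_) (by simp))
  exact Finset.prod_le_one' fun e _ => ENNReal.ofReal_le_one.2 (pairProb ν n h e).2.2

/-- The clique probability is at most a power of `∫ f`, if the product of the edge probabilities
is dominated by a product of values of `f`. -/
theorem ofReal_cliqueProb_le (ν : Measure ℝ≥0) [IsProbabilityMeasure ν] (n : ℕ)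
    (s : Finset (Fin n)) {f : ℝ≥0 → ℝ} (hf : Measurable f) (hf0 : ∀ x, 0 ≤ f x)
    (hle : ∀ h : Fin n → ℝ≥0, ∏ e ∈ pairs s, (pairProb ν n h e : ℝ) ≤ ∏ i ∈ s, f (h i)) :
    ENNReal.ofReal (cliqueProb ν n s) ≤ (∫⁻ x, ENNReal.ofReal (f x) ∂ν) ^ s.card := by
  rw [ofReal_cliqueProb, ← lintegral_pi_prod_eq_prod_lintegral ν s hf.ennreal_ofReal]
  refine lintegral_mono fun h => ?_
  rw [← ENNReal.ofReal_prod_of_nonneg fun e _ => (pairProb ν n h e).2.1,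
    ← ENNReal.ofReal_prod_of_nonneg fun i _ => hf0 _]
  exact ENNReal.ofReal_le_ofReal (hle h)

/-- The clique probability is bounded below by the contribution of the weights larger than `m`. -/
theorem le_cliqueProb (ν : Measure ℝ≥0) [IsProbabilityMeasure ν] (n : ℕ)
    (s : Finset (Fin n)) (m : ℝ) (hm : 0 ≤ m) :
    min (m ^ 2 / (mean ν * n)) 1 ^ (pairs s).card * ν.real {x : ℝ≥0 | m < x} ^ s.card ≤
      cliqueProb ν n s := by
  have hr : 0 ≤ min (m ^ 2 / (mean ν * n)) 1 :=
    le_min (div_nonneg (sq_nonneg m) (mul_nonneg (mean_nonneg ν) n.cast_nonneg)) zero_le_one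
  have hmeas : MeasurableSet {x : ℝ≥0 | m < x} := measurableSet_lt measurable_const (by fun_prop)
  have hcl : 0 ≤ cliqueProb ν n s := measureReal_nonneg
  rw [← ENNReal.ofReal_le_ofReal_iff hcl, ofReal_cliqueProb,
    ENNReal.ofReal_mul (pow_nonneg hr _), ENNReal.ofReal_pow hr,
    ENNReal.ofReal_pow measureReal_nonneg, ofReal_measureReal,
    ← lintegral_indicator_one hmeas,
    ← lintegral_pi_prod_eq_prod_lintegral ν s (measurable_one.indicator hmeas)]
  rw [← lintegral_const_mul]
  swap
  · exact Finset.measurable_prod _ fun i _ =>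
      (measurable_one.indicator hmeas).comp (measurable_pi_apply i)
  refine lintegral_mono fun h => ?_
  by_cases hh : ∀ i ∈ s, m < h i
  · refine (mul_le_of_le_one_right' (Finset.prod_le_one' fun i _ => ?_)).trans ?_
    · exact Set.indicator_le_self' (fun _ _ => zero_le_one) _ |>.trans le_rfl
    rw [← Finset.prod_const]
    refine Finset.prod_le_prod' fun e he => ENNReal.ofReal_le_ofReal ?_
    induction e with
    | h i j =>
      simp only [pairs, Finset.mem_filter, Finset.mk_mem_sym2_iff, Sym2.mk_isDiag_iff] at he
      refine min_le_min_right _ (div_le_div_of_nonneg_right ?_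
        (mul_nonneg (mean_nonneg ν) n.cast_nonneg))
      rw [sq]
      exact mul_le_mul (hh i he.1.1).le (hh j he.1.2).le hm (h i).2
  · push Not at hh
    obtain ⟨i, hi, hle⟩ := hh
    rw [Finset.prod_eq_zero hi, mul_zero]
    · exact zero_le
    · simp [hle]

end ChungLu

/-! ### Deterministic inequalities for products over pairs -/

namespace ChungLu

/-- `min (tᵢ + tⱼ) 0` as a function of the unordered pair `{i, j}`. -/
def truncSum {ι : Type*} (t : ι → ℝ) : Sym2 ι → ℝ :=
  Sym2.lift ⟨fun i j => min (t i + t j) 0, fun i j => by simp only [add_comm]⟩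

/-- `min (xᵢ xⱼ) 1` as a function of the unordered pair `{i, j}`. -/
def truncProd {ι : Type*} (x : ι → ℝ) : Sym2 ι → ℝ :=
  Sym2.lift ⟨fun i j => min (x i * x j) 1, fun i j => by simp only [mul_comm]⟩

@[simp]
theorem truncSum_mk {ι : Type*} (t : ι → ℝ) (i j : ι) : truncSum t s(i, j) = min (t i + t j) 0 :=
  rfl

@[simp]
theorem truncProd_mk {ι : Type*} (x : ι → ℝ) (i j : ι) : truncProd x s(i, j) = min (x i * x j) 1 :=
  rfl

/-- The linear order selects one orientation of each pair; swapping matches it with the other one.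
-/
theorem two_mul_sum_pairs {ι : Type*} [LinearOrder ι] (s : Finset ι) (p : ι → ι → ℝ)
    (hp : ∀ i j, p i j = p j i) :
    2 * ∑ e ∈ pairs s, Sym2.lift ⟨p, hp⟩ e = ∑ x ∈ s.offDiag, p x.1 x.2 := by
  rw [pairs, Finset.sum_sym2_filter_not_isDiag]
  simp only [Sym2.lift_mk]
  have hswap : ∑ x ∈ s.offDiag with x.1 < x.2, p x.1 x.2 =
      ∑ x ∈ s.offDiag with ¬ x.1 < x.2, p x.1 x.2 := by
    refine Finset.sum_nbij' Prod.swap Prod.swap ?_ ?_ ?_ ?_ ?_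
    · rintro ⟨i, j⟩ h
      simp only [Finset.mem_filter, Finset.mem_offDiag, Prod.swap] at h ⊢
      exact ⟨⟨h.1.2.1, h.1.1, h.1.2.2.symm⟩, h.2.not_gt⟩
    · rintro ⟨i, j⟩ h
      simp only [Finset.mem_filter, Finset.mem_offDiag, Prod.swap] at h ⊢
      exact ⟨⟨h.1.2.1, h.1.1, h.1.2.2.symm⟩, lt_of_le_of_ne (not_lt.1 h.2) h.1.2.2.symm⟩
    · simp
    · simp
    · rintro ⟨i, j⟩ _
      exact hp i j
  rw [two_mul]
  nth_rw 2 [hswap]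
  exact Finset.sum_filter_add_sum_filter_not _ _ _

theorem sum_offDiag_add {ι : Type*} [DecidableEq ι] (s : Finset ι) (t : ι → ℝ) :
    ∑ x ∈ s.offDiag, (t x.1 + t x.2) = 2 * ((s.card - 1) * ∑ i ∈ s, t i) := by
  have h1 : ∑ x ∈ s ×ˢ s, (t x.1 + t x.2) = 2 * (s.card * ∑ i ∈ s, t i) := by
    rw [Finset.sum_product]
    simp only [Finset.sum_add_distrib, Finset.sum_const, nsmul_eq_mul, ← Finset.mul_sum]
    ring
  have h2 : ∑ x ∈ s.diag, (t x.1 + t x.2) = 2 * ∑ i ∈ s, t i := by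
    rw [Finset.sum_diag, Finset.mul_sum]
    exact Finset.sum_congr rfl fun i _ => (two_mul _).symm
  have h3 := Finset.sum_union (f := fun x : ι × ι => t x.1 + t x.2) (Finset.disjoint_diag_offDiag s)
  rw [Finset.diag_union_offDiag, h1, h2] at h3
  linarith

theorem sum_pairs_add {ι : Type*} [LinearOrder ι] (s : Finset ι) (t : ι → ℝ) :
    ∑ e ∈ pairs s, Sym2.lift ⟨fun i j => t i + t j, fun _ _ => add_comm _ _⟩ e =
      (s.card - 1) * ∑ i ∈ s, t i := by
  have h := two_mul_sum_pairs s (fun i j => t i + t j) fun _ _ => add_comm _ _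
  rw [sum_offDiag_add] at h
  linarith

/-- Three distinct indices give `2 tᵢ = (tᵢ + tⱼ) + (tᵢ + tₗ) - (tⱼ + tₗ)`. With only two indices,
`t = (1, -1)` is a counterexample. -/
theorem sum_abs_le_sum_offDiag {ι : Type*} [DecidableEq ι] (s : Finset ι) (hs : 3 ≤ s.card)
    (t : ι → ℝ) :
    ∑ i ∈ s, |t i| ≤ s.card * (3 / 2 * ∑ x ∈ s.offDiag, |t x.1 + t x.2|) := by
  rw [← nsmul_eq_mul]
  refine Finset.sum_le_card_nsmul _ _ _ fun i hi => ?_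
  have hle : ∀ j ∈ s, ∀ l ∈ s, j ≠ l → |t j + t l| ≤ ∑ x ∈ s.offDiag, |t x.1 + t x.2| := by
    intro j hj l hl hjl
    exact Finset.single_le_sum (f := fun x : ι × ι => |t x.1 + t x.2|) (fun _ _ => abs_nonneg _)
      (a := (j, l)) (Finset.mem_offDiag.2 ⟨hj, hl, hjl⟩)
  have hcard : 1 < (s.erase i).card := by
    rw [Finset.card_erase_of_mem hi]; omega
  obtain ⟨j, hj, l, hl, hjl⟩ := Finset.one_lt_card.1 hcard
  rw [Finset.mem_erase] at hj hl
  have h1 := abs_le.1 (hle i hi j hj.2 hj.1.symm)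
  have h2 := abs_le.1 (hle i hi l hl.2 hl.1.symm)
  have h3 := abs_le.1 (hle j hj.2 l hl.2 hjl)
  exact abs_le.2 ⟨by linarith, by linarith⟩

/-- The gap `θ u - min u 0` equals `θ |u|` for `u ≥ 0` and `(1 - θ) |u|` for `u ≤ 0`. -/
theorem min_zero_le (u θ δ : ℝ) (h0 : δ ≤ θ) (h1 : δ ≤ 1 - θ) : min u 0 ≤ θ * u - δ * |u| := by
  rcases le_total 0 u with h | h
  · rw [min_eq_right h, abs_of_nonneg h]; nlinarith
  · rw [min_eq_left h, abs_of_nonpos h]; nlinarith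

/-- The sum of the `min (tᵢ + tⱼ) 0` over the pairs lies strictly below every linear function
`β ∑ tᵢ` with `0 < β < k - 1`. -/
theorem exists_sum_pairs_min_le (k : ℕ) (hk : 3 ≤ k) {β : ℝ} (h0 : 0 < β) (h1 : β < k - 1) :
    ∃ c₀ > 0, ∀ c ≤ c₀, ∀ {ι : Type} [LinearOrder ι] (s : Finset ι), s.card = k → ∀ t : ι → ℝ,
      ∑ e ∈ pairs s, truncSum t e ≤
        ∑ i ∈ s, (β * t i - c * |t i|) := by
  have hk' : (3 : ℝ) ≤ k := by exact_mod_cast hk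
  have hk1 : (0 : ℝ) < k - 1 := by linarith
  -- Each index lies in `k - 1` pairs, so `θ` times the sum of `tᵢ + tⱼ` over the pairs is `β ∑ tᵢ`.
  set θ : ℝ := β / (k - 1) with hθ
  have hθk : θ * (k - 1) = β := div_mul_cancel₀ _ hk1.ne'
  have hθ0 : 0 < θ := div_pos h0 hk1
  have hθ1 : θ < 1 := (div_lt_one hk1).2 h1
  set δ := min θ (1 - θ) with hδ
  have hδ0 : 0 < δ := lt_min hθ0 (by linarith)
  -- Chosen so that `δ / (3 k) · k · 3 / 2 = δ / 2`; the half appears because ordered pairs count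
  -- each pair twice.
  refine ⟨δ / (3 * k), by positivity, fun c hc ι _ s hs t => ?_⟩
  have h2 := two_mul_sum_pairs s (fun i j => min (t i + t j) 0) fun i j => by simp only [add_comm]
  have h3 : ∑ x ∈ s.offDiag, min (t x.1 + t x.2) 0 ≤
      θ * ∑ x ∈ s.offDiag, (t x.1 + t x.2) - δ * ∑ x ∈ s.offDiag, |t x.1 + t x.2| := by
    rw [Finset.mul_sum, Finset.mul_sum, ← Finset.sum_sub_distrib]
    exact Finset.sum_le_sum fun x _ => min_zero_le _ _ _ (min_le_left _ _) (min_le_right _ _)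
  have h4 := sum_abs_le_sum_offDiag s (hs ▸ hk) t
  rw [sum_offDiag_add, hs] at h3
  rw [hs] at h4
  have h5 : c * ∑ i ∈ s, |t i| ≤ δ / 2 * ∑ x ∈ s.offDiag, |t x.1 + t x.2| := by
    have h6 : δ / (3 * k) * ∑ i ∈ s, |t i| ≤
        δ / (3 * k) * (k * (3 / 2 * ∑ x ∈ s.offDiag, |t x.1 + t x.2|)) :=
      mul_le_mul_of_nonneg_left h4 (by positivity)
    have h7 : c * ∑ i ∈ s, |t i| ≤ δ / (3 * k) * ∑ i ∈ s, |t i| :=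
      mul_le_mul_of_nonneg_right hc (Finset.sum_nonneg fun _ _ => abs_nonneg _)
    refine h7.trans (h6.trans (le_of_eq ?_))
    field_simp
  change 2 * ∑ e ∈ pairs s, truncSum t e = _ at h2
  rw [Finset.sum_sub_distrib, ← Finset.mul_sum, ← Finset.mul_sum]
  have h8 : θ * (2 * ((k - 1) * ∑ i ∈ s, t i)) = 2 * (β * ∑ i ∈ s, t i) := by
    rw [← hθk]; ring
  linarith

theorem prod_pairs_eq_zero {ι : Type*} [DecidableEq ι] {s : Finset ι} (hs : 2 ≤ s.card)
    (x : ι → ℝ) {i : ι} (hi : i ∈ s) (hx : x i = 0) :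
    ∏ e ∈ pairs s, truncProd x e = 0 := by
  have hcard : 0 < (s.erase i).card := by
    rw [Finset.card_erase_of_mem hi]; omega
  obtain ⟨j, hj⟩ := Finset.card_pos.1 hcard
  rw [Finset.mem_erase] at hj
  refine Finset.prod_eq_zero (i := s(i, j)) ?_ ?_
  · simp [pairs, hi, hj.2, hj.1.symm]
  · simp [hx]

theorem prod_pairs_min_exp {ι : Type*} [DecidableEq ι] (s : Finset ι) (t : ι → ℝ) :
    ∏ e ∈ pairs s, truncProd (fun i => Real.exp (t i)) e =
    Real.exp (∑ e ∈ pairs s, truncSum t e) := by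
  rw [Real.exp_sum]
  refine Finset.prod_congr rfl fun e _ => ?_
  induction e with
  | h i j =>
    rw [truncProd_mk, truncSum_mk, Real.exp_monotone.map_min, Real.exp_add, Real.exp_zero]

/-- Logarithms reduce the product to a sum when all coordinates in `s` are positive. A zero
coordinate lies in some pair, as `s` has at least two elements, and kills the left side. -/
theorem prod_pairs_min_le_of_log {ι : Type*} [DecidableEq ι] {s : Finset ι} (hs : 2 ≤ s.card)
    {x : ι → ℝ} (hx : ∀ i, 0 ≤ x i) {f g : ℝ → ℝ} (hf : ∀ y, 0 ≤ y → 0 ≤ f y)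
    (hfg : ∀ t, Real.exp (g t) = f (Real.exp t))
    (hle : ∀ t : ι → ℝ, ∑ e ∈ pairs s, truncSum t e ≤ ∑ i ∈ s, g (t i)) :
    ∏ e ∈ pairs s, truncProd x e ≤
      ∏ i ∈ s, f (x i) := by
  by_cases h0 : ∃ i ∈ s, x i = 0
  · obtain ⟨i, hi, hi0⟩ := h0
    rw [prod_pairs_eq_zero hs x hi hi0]
    exact Finset.prod_nonneg fun j _ => hf _ (hx j)
  · push Not at h0
    have hexp : ∀ i ∈ s, Real.exp (Real.log (x i)) = x i := fun i hi =>
      Real.exp_log (lt_of_le_of_ne (hx i) (h0 i hi).symm)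
    have h1 := Real.exp_le_exp.2 (hle fun i => Real.log (x i))
    rw [← prod_pairs_min_exp, Real.exp_sum] at h1
    convert h1 using 1
    · refine Finset.prod_congr rfl fun e he => ?_
      induction e with
      | h i j =>
        simp only [pairs, Finset.mem_filter, Finset.mk_mem_sym2_iff] at he
        rw [truncProd_mk, truncProd_mk, hexp i he.1.1, hexp j he.1.2]
    · refine Finset.prod_congr rfl fun i hi => ?_
      rw [hfg, hexp i hi]

/-- With `y = exp t`, `exp (β t - c |t|)` is the minimum of `y ^ (β + c)` and `y ^ (β - c)`. -/
theorem exists_prod_pairs_min_le (k : ℕ) (hk : 3 ≤ k) {β : ℝ} (h0 : 0 < β) (h1 : β < k - 1) :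
    ∃ c₀ > 0, ∀ c, 0 ≤ c → c ≤ c₀ → ∀ {ι : Type} [LinearOrder ι] (s : Finset ι), s.card = k →
      ∀ x : ι → ℝ, (∀ i, 0 ≤ x i) →
      ∏ e ∈ pairs s, truncProd x e ≤
        ∏ i ∈ s, min (x i ^ (β + c)) (x i ^ (β - c)) := by
  obtain ⟨c₀, hc₀, h⟩ := exists_sum_pairs_min_le k hk h0 h1
  refine ⟨c₀, hc₀, fun c hc0 hc ι _ s hs x hx => ?_⟩
  refine prod_pairs_min_le_of_log (g := fun t => β * t - c * |t|)
    (f := fun y => min (y ^ (β + c)) (y ^ (β - c))) (by omega) hx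
    (fun y hy => le_min (Real.rpow_nonneg hy _) (Real.rpow_nonneg hy _)) (fun t => ?_) (h c hc s hs)
  rw [← Real.exp_mul, ← Real.exp_mul, ← Real.exp_monotone.map_min]
  congr 1
  rcases le_total 0 t with ht | ht
  · rw [abs_of_nonneg ht, min_eq_right (by nlinarith)]; ring
  · rw [abs_of_nonpos ht, min_eq_left (by nlinarith)]; ring

theorem prod_pairs_min_le_prod_rpow {ι : Type} [LinearOrder ι] (s : Finset ι) (hs : 2 ≤ s.card)
    (x : ι → ℝ) (hx : ∀ i, 0 ≤ x i) :
    ∏ e ∈ pairs s, truncProd x e ≤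
      ∏ i ∈ s, x i ^ ((s.card : ℝ) - 1) := by
  refine prod_pairs_min_le_of_log (g := fun t => (s.card - 1) * t) hs hx
    (f := fun y => y ^ ((s.card : ℝ) - 1)) (fun y hy => Real.rpow_nonneg hy _)
    (fun t => ?_) (fun t => ?_)
  · rw [← Real.exp_mul, mul_comm]
  · rw [← Finset.mul_sum, ← sum_pairs_add]
    refine Finset.sum_le_sum fun e _ => ?_
    induction e with
    | h i j => exact min_le_left _ _

end ChungLu

/-! ### Regularly varying tails and truncated moments -/

namespace ChungLu

/-- The tail `x ↦ ℙ(H > x)` of the weight distribution. -/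
noncomputable def tail (ν : Measure ℝ≥0) (x : ℝ) : ℝ := ν.real {y : ℝ≥0 | x < (y : ℝ)}

theorem measurableSet_lt_coe (x : ℝ) : MeasurableSet {y : ℝ≥0 | x < (y : ℝ)} :=
  measurableSet_lt measurable_const (by fun_prop)

theorem tail_nonneg (ν : Measure ℝ≥0) (x : ℝ) : 0 ≤ tail ν x := measureReal_nonneg

theorem tail_le_one (ν : Measure ℝ≥0) [IsProbabilityMeasure ν] (x : ℝ) : tail ν x ≤ 1 :=
  measureReal_le_one

theorem tail_antitone (ν : Measure ℝ≥0) [IsProbabilityMeasure ν] : Antitone (tail ν) :=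
  fun _ _ hxy => measureReal_mono fun _ hz => lt_of_le_of_lt hxy hz

/-- The weight distribution has a tail which is positive and regularly varying of index `-β`. -/
structure RegularTail (ν : Measure ℝ≥0) (β : ℝ) : Prop where
  pos : ∀ x, 0 < tail ν x
  tendsto : ∀ c : ℝ, 0 < c → Tendsto (fun x => tail ν (c * x) / tail ν x) atTop (𝓝 (c ^ (-β)))

theorem regularTail_of_slowlyVarying (ν : Measure ℝ≥0) [IsProbabilityMeasure ν] {α : ℝ}
    {l : ℝ → ℝ} (hl : SlowlyVarying l)
    (htail : ∀ h : ℝ, 1 ≤ h → tail ν h = h ^ (1 - α) * l h) : RegularTail ν (α - 1) := by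
  constructor
  · intro x
    -- Division by zero gives 0, so a nonzero quotient forces `l y ≠ 0`; monotonicity then carries
    -- positivity of the tail from large `y` to all `x`.
    have h1 := (hl 2 two_pos).eventually_ne one_ne_zero
    obtain ⟨y, hy, hyx, hy1⟩ :=
      (h1.and ((eventually_ge_atTop x).and (eventually_ge_atTop 1))).exists
    refine lt_of_lt_of_le (lt_of_le_of_ne (tail_nonneg ν y) (Ne.symm ?_)) (tail_antitone ν hyx)
    rw [htail y hy1]
    refine mul_ne_zero (Real.rpow_pos_of_pos (by linarith) _).ne' fun h0 => hy ?_
    rw [h0, div_zero]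
  · intro c hc
    have h2 := (hl c hc).const_mul (c ^ (-(α - 1)))
    rw [mul_one] at h2
    refine h2.congr' ?_
    filter_upwards [eventually_ge_atTop 1, eventually_ge_atTop (1 / c)] with x hx1 hxc
    have hcx : 1 ≤ c * x := by
      rw [div_le_iff₀ hc] at hxc; linarith
    have hx0 : 0 < x := by linarith
    rw [htail _ hcx, htail x hx1, Real.mul_rpow hc.le hx0.le, neg_sub]
    have := (Real.rpow_pos_of_pos hx0 (1 - α)).ne'
    field_simp

theorem RegularTail.exists_dyadic_bounds {ν : Measure ℝ≥0} [IsProbabilityMeasure ν] {β : ℝ}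
    (hν : RegularTail ν β) {ε : ℝ} (hε : 0 < ε) :
    ∃ m₀ : ℝ, 1 ≤ m₀ ∧ ∀ m, m₀ ≤ m → tail ν (2 * m) ≤ (2 : ℝ) ^ (-(β - ε)) * tail ν m ∧
      tail ν m ≤ (2 : ℝ) ^ (β + ε) * tail ν (2 * m) := by
  have h := hν.tendsto 2 two_pos
  have h1 : (2 : ℝ) ^ (-β) < 2 ^ (-(β - ε)) :=
    Real.rpow_lt_rpow_of_exponent_lt one_lt_two (by linarith)
  have h2 : (2 : ℝ) ^ (-(β + ε)) < 2 ^ (-β) :=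
    Real.rpow_lt_rpow_of_exponent_lt one_lt_two (by linarith)
  obtain ⟨m₀, hm₀⟩ := eventually_atTop.1 ((h.eventually_lt_const h1).and
    (h.eventually_const_lt h2))
  refine ⟨max m₀ 1, le_max_right _ _, fun m hm => ?_⟩
  obtain ⟨h3, h4⟩ := hm₀ m ((le_max_left _ _).trans hm)
  refine ⟨((div_lt_iff₀ (hν.pos m)).1 h3).le, ?_⟩
  rw [lt_div_iff₀ (hν.pos m), Real.rpow_neg zero_le_two] at h4
  have h5 : (0 : ℝ) < 2 ^ (β + ε) := Real.rpow_pos_of_pos two_pos _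
  rw [← div_le_iff₀' h5, div_eq_inv_mul]
  exact h4.le

/-- Potter-type bounds along powers of 2, by iterating the doubling bounds. Going down, the
iteration stops below `2 * m₀`, where the trivial bound 1 on the tail costs the constant `1 / tail ν
(2 * m₀)`. -/
theorem RegularTail.exists_tail_le {ν : Measure ℝ≥0} [IsProbabilityMeasure ν] {β : ℝ}
    (hν : RegularTail ν β) {ε : ℝ} (hε : 0 < ε) (hβ : 0 < β) :
    ∃ m₀ C : ℝ, 1 ≤ m₀ ∧ 0 < C ∧ ∀ m, m₀ ≤ m → ∀ j : ℕ,
      tail ν (2 ^ j * m) ≤ ((2 : ℝ) ^ (-(β - ε))) ^ j * tail ν m ∧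
      tail ν (m / 2 ^ j) ≤ C * ((2 : ℝ) ^ (β + ε)) ^ j * tail ν m := by
  obtain ⟨m₀, hm₀, hb⟩ := hν.exists_dyadic_bounds hε
  have hT := hν.pos (2 * m₀)
  have hq : (1 : ℝ) ≤ 2 ^ (β + ε) := Real.one_le_rpow one_le_two (by linarith)
  have hC : 1 ≤ 1 / tail ν (2 * m₀) := by
    rw [le_div_iff₀ hT, one_mul]; exact tail_le_one ν _
  refine ⟨m₀, 1 / tail ν (2 * m₀), hm₀, by positivity, fun m hm j => ⟨?_, ?_⟩⟩
  · induction j with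
    | zero => simp
    | succ j ih =>
      have h1 : m₀ ≤ 2 ^ j * m := by
        have : (1 : ℝ) ≤ 2 ^ j := one_le_pow₀ one_le_two
        nlinarith
      have h2 := (hb _ h1).1
      rw [show (2 : ℝ) ^ (j + 1) * m = 2 * (2 ^ j * m) by ring, pow_succ', mul_assoc]
      exact h2.trans (mul_le_mul_of_nonneg_left ih (by positivity))
  · induction j generalizing m with
    | zero =>
      have := hν.pos m
      simp only [pow_zero, div_one, mul_one]
      nlinarith
    | succ j ih =>
      rcases le_total m (2 * m₀) with h | h
      · have h1 : tail ν (2 * m₀) ≤ tail ν m := tail_antitone ν h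
        have h2 : (1 : ℝ) ≤ (2 ^ (β + ε)) ^ (j + 1) := one_le_pow₀ hq
        calc tail ν (m / 2 ^ (j + 1)) ≤ 1 := tail_le_one ν _
          _ = 1 / tail ν (2 * m₀) * 1 * tail ν (2 * m₀) := by field_simp
          _ ≤ _ := by gcongr
      · have h1 := ih (m / 2) (by linarith)
        have h2 := (hb (m / 2) (by linarith)).2
        rw [show 2 * (m / 2) = m by ring] at h2
        calc tail ν (m / 2 ^ (j + 1)) = tail ν (m / 2 / 2 ^ j) := by rw [pow_succ', div_div]
          _ ≤ _ := h1
          _ ≤ 1 / tail ν (2 * m₀) * (2 ^ (β + ε)) ^ j * (2 ^ (β + ε) * tail ν m) := by gcongr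
          _ = _ := by ring

open scoped ENNReal

/-- A dyadic majorant of `y ↦ min (y ^ a) (y ^ b)`, made of indicators of half-lines. -/
theorem ofReal_min_rpow_le_tsum {a b : ℝ} (ha : 0 < a) (hb : 0 ≤ b) {y : ℝ} (hy : 0 ≤ y) :
    ENNReal.ofReal (min (y ^ a) (y ^ b)) ≤
      ∑' j : ℕ, ENNReal.ofReal (((2 : ℝ) ^ b) ^ 2 * ((2 : ℝ) ^ b) ^ j) *
        (Set.Ioi ((2 : ℝ) ^ j)).indicator 1 y +
      ∑' j : ℕ, ENNReal.ofReal ((2 : ℝ) ^ a * ((2 : ℝ) ^ (-a)) ^ j) *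
        (Set.Ioi (1 / (2 : ℝ) ^ j)).indicator 1 y := by
  rcases hy.eq_or_lt with rfl | hy
  · rw [Real.zero_rpow ha.ne']
    refine le_trans (ENNReal.ofReal_le_ofReal (min_le_left _ _)) (by simp)
  rcases lt_or_ge 1 y with h1 | h1
  · obtain ⟨n, hn, hn'⟩ := exists_nat_pow_near h1.le one_lt_two
    -- The half-lines are open and `y = 2 ^ n` is possible, hence the step back to `n - 1` (which is
    -- 0 when `n = 0`). The factor `((2 : ℝ) ^ b) ^ 2` pays for it.
    have hlt : (2 : ℝ) ^ (n - 1) < y := by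
      rcases n with _ | n
      · simpa using h1
      · exact lt_of_lt_of_le (pow_lt_pow_right₀ one_lt_two (by simp)) hn
    refine le_trans ?_ le_self_add
    refine le_trans ?_ (ENNReal.le_tsum (n - 1))
    rw [Set.indicator_of_mem (Set.mem_Ioi.2 hlt), Pi.one_apply, mul_one]
    refine ENNReal.ofReal_le_ofReal ((min_le_right _ _).trans ?_)
    refine (Real.rpow_le_rpow hy.le hn'.le hb).trans ?_
    rw [← pow_add, ← Real.rpow_natCast, ← Real.rpow_mul zero_le_two, mul_comm,
      Real.rpow_mul zero_le_two, Real.rpow_natCast]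
    exact pow_le_pow_right₀ (Real.one_le_rpow one_le_two hb) (by omega)
  · obtain ⟨n, hn, hn'⟩ := exists_nat_pow_near_of_lt_one hy h1 (y := (1 / 2 : ℝ)) (by norm_num)
      (by norm_num)
    refine le_trans ?_ le_add_self
    refine le_trans ?_ (ENNReal.le_tsum (n + 1))
    rw [Set.indicator_of_mem (by simpa using hn), Pi.one_apply, mul_one]
    refine ENNReal.ofReal_le_ofReal ((min_le_left _ _).trans ?_)
    refine (Real.rpow_le_rpow hy.le hn' ha.le).trans (le_of_eq ?_)
    rw [pow_succ', ← mul_assoc, ← Real.rpow_add two_pos, add_neg_cancel, Real.rpow_zero, one_mul,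
      ← Real.rpow_natCast, ← Real.rpow_natCast, ← Real.rpow_mul zero_le_two, one_div,
      Real.inv_rpow zero_le_two, ← Real.rpow_neg zero_le_two, ← Real.rpow_mul zero_le_two]
    congr 1; ring

theorem tsum_ofReal_geometric_le {r A : ℝ} (hr0 : 0 ≤ r) (hr1 : r < 1) (hA : 0 ≤ A) :
    ∑' j : ℕ, ENNReal.ofReal (A * r ^ j) = ENNReal.ofReal (A / (1 - r)) := by
  rw [← ENNReal.ofReal_tsum_of_nonneg (fun j => by positivity)
    ((summable_geometric_of_lt_one hr0 hr1).mul_left A), tsum_mul_left,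
    tsum_geometric_of_lt_one hr0 hr1, div_eq_mul_inv]

theorem lintegral_indicator_Ioi_div (ν : Measure ℝ≥0) [IsProbabilityMeasure ν] {m : ℝ} (hm : 0 < m)
    (z : ℝ) :
    ∫⁻ x : ℝ≥0, (Set.Ioi z).indicator 1 ((x : ℝ) / m) ∂ν = ENNReal.ofReal (tail ν (z * m)) := by
  rw [tail, ofReal_measureReal, ← lintegral_indicator_one (measurableSet_lt_coe _)]
  refine lintegral_congr fun x => ?_
  simp [Set.indicator, lt_div_iff₀ hm]

/-- The truncated moments of the weights at scale `m` are of the order of the tail at `m`. -/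
theorem RegularTail.exists_lintegral_le {ν : Measure ℝ≥0} [IsProbabilityMeasure ν] {β c : ℝ}
    (hν : RegularTail ν β) (hc : 0 < c) (hcβ : c ≤ β) :
    ∃ m₀ K : ℝ, 1 ≤ m₀ ∧ 0 < K ∧ ∀ m, m₀ ≤ m →
      ∫⁻ x : ℝ≥0, ENNReal.ofReal (min (((x : ℝ) / m) ^ (β + c)) (((x : ℝ) / m) ^ (β - c))) ∂ν ≤
        ENNReal.ofReal (K * tail ν m) := by
  -- Losing only `c / 2` in the tail exponents against the gain `c` makes both dyadic series
  -- geometric of ratio `2 ^ (-(c / 2))`.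
  obtain ⟨m₀, C, hm₀, hC, hb⟩ := hν.exists_tail_le (half_pos hc) (hc.trans_le hcβ)
  set r : ℝ := 2 ^ (-(c / 2)) with hr
  have hr0 : 0 < r := Real.rpow_pos_of_pos two_pos _
  have hr1 : r < 1 := Real.rpow_lt_one_of_one_lt_of_neg one_lt_two (by linarith)
  have hr1' : 0 < 1 - r := by linarith
  set A : ℝ := (2 ^ (β - c)) ^ 2 with hA
  set B : ℝ := 2 ^ (β + c) * C with hB
  have hA0 : 0 < A := by positivity
  have hB0 : 0 < B := by positivity
  refine ⟨m₀, (A + B) / (1 - r), hm₀, by positivity, fun m hm => ?_⟩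
  have hm0 : 0 < m := by linarith
  have hT := hν.pos m
  have hdiv : Measurable fun x : ℝ≥0 => (x : ℝ) / m := by fun_prop
  have hind (z : ℝ) : Measurable fun x : ℝ≥0 => (Set.Ioi z).indicator (1 : ℝ → ℝ≥0∞) ((x : ℝ) / m) :=
    (measurable_one.indicator measurableSet_Ioi).comp hdiv
  refine (lintegral_mono fun x => ofReal_min_rpow_le_tsum (a := β + c) (b := β - c) (by linarith)
    (by linarith) (div_nonneg x.2 hm0.le)).trans ?_
  rw [lintegral_add_left (Measurable.tsum fun j => (hind _).const_mul _),
    lintegral_tsum fun j => ((hind _).const_mul _).aemeasurable,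
    lintegral_tsum fun j => ((hind _).const_mul _).aemeasurable]
  simp_rw [lintegral_const_mul _ (hind _), lintegral_indicator_Ioi_div ν hm0]
  rw [show (A + B) / (1 - r) * tail ν m = A * tail ν m / (1 - r) + B * tail ν m / (1 - r) by ring,
    ENNReal.ofReal_add (by positivity) (by positivity),
    ← tsum_ofReal_geometric_le hr0.le hr1 (by positivity),
    ← tsum_ofReal_geometric_le hr0.le hr1 (by positivity)]
  refine add_le_add (ENNReal.tsum_le_tsum fun j => ?_) (ENNReal.tsum_le_tsum fun j => ?_)
  · rw [← ENNReal.ofReal_mul (by positivity)]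
    refine ENNReal.ofReal_le_ofReal ?_
    have h1 := (hb m hm j).1
    have h2 : r = 2 ^ (β - c) * 2 ^ (-(β - c / 2)) := by
      rw [hr, ← Real.rpow_add two_pos]; congr 1; ring
    calc A * (2 ^ (β - c)) ^ j * tail ν (2 ^ j * m)
        ≤ A * (2 ^ (β - c)) ^ j * ((2 ^ (-(β - c / 2))) ^ j * tail ν m) := by gcongr
      _ = A * tail ν m * r ^ j := by rw [h2, mul_pow]; ring
  · rw [← ENNReal.ofReal_mul (by positivity)]
    refine ENNReal.ofReal_le_ofReal ?_
    have h1 := (hb m hm j).2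
    have h2 : r = 2 ^ (-(β + c)) * 2 ^ (β + c / 2) := by
      rw [hr, ← Real.rpow_add two_pos]; congr 1; ring
    calc 2 ^ (β + c) * (2 ^ (-(β + c))) ^ j * tail ν (1 / 2 ^ j * m)
        ≤ 2 ^ (β + c) * (2 ^ (-(β + c))) ^ j * (C * (2 ^ (β + c / 2)) ^ j * tail ν m) := by
          rw [one_div_mul_eq_div]; gcongr
      _ = B * tail ν m * r ^ j := by rw [h2, mul_pow]; ring

/-- The moments of order less than `β` are finite. -/
theorem RegularTail.lintegral_rpow_lt_top {ν : Measure ℝ≥0} [IsProbabilityMeasure ν] {β p : ℝ}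
    (hν : RegularTail ν β) (hp : 0 ≤ p) (hpβ : p < β) :
    ∫⁻ x : ℝ≥0, ENNReal.ofReal ((x : ℝ) ^ p) ∂ν < ∞ := by
  -- With `c = β - p` the truncated moment at one fixed scale `m` already controls `x ^ p` for `x ≥
  -- m`.
  obtain ⟨m, K, hm, hK, h⟩ := hν.exists_lintegral_le (c := β - p) (by linarith) (by linarith)
  specialize h m le_rfl
  rw [sub_sub_cancel] at h
  have hm0 : 0 < m := by linarith
  have hle (x : ℝ≥0) : ENNReal.ofReal ((x : ℝ) ^ p) ≤ ENNReal.ofReal (m ^ p) *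
      (1 + ENNReal.ofReal (min (((x : ℝ) / m) ^ (β + (β - p))) (((x : ℝ) / m) ^ p))) := by
    have hx : 0 ≤ (x : ℝ) / m := div_nonneg x.2 hm0.le
    have hmp : 0 ≤ m ^ p := Real.rpow_nonneg hm0.le p
    have hmin : 0 ≤ min (((x : ℝ) / m) ^ (β + (β - p))) (((x : ℝ) / m) ^ p) :=
      le_min (Real.rpow_nonneg hx _) (Real.rpow_nonneg hx _)
    rw [← ENNReal.ofReal_one, ← ENNReal.ofReal_add zero_le_one hmin, ← ENNReal.ofReal_mul hmp]
    refine ENNReal.ofReal_le_ofReal ?_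
    have hxm : (x : ℝ) ^ p = m ^ p * ((x : ℝ) / m) ^ p := by
      rw [← Real.mul_rpow hm0.le hx, mul_div_cancel₀ _ hm0.ne']
    rw [hxm]
    refine mul_le_mul_of_nonneg_left ?_ hmp
    rcases le_total ((x : ℝ) / m) 1 with h1 | h1
    · have := Real.rpow_le_one hx h1 hp
      linarith
    · rw [min_eq_right (Real.rpow_le_rpow_of_exponent_le h1 (by linarith))]
      linarith
  refine (lintegral_mono hle).trans_lt ?_
  rw [lintegral_const_mul _ (by fun_prop), lintegral_add_left (by fun_prop)]
  refine ENNReal.mul_lt_top ENNReal.ofReal_lt_top (ENNReal.add_lt_top.2 ⟨by simp, ?_⟩)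
  exact h.trans_lt ENNReal.ofReal_lt_top

theorem RegularTail.mean_pos {ν : Measure ℝ≥0} [IsProbabilityMeasure ν] {β : ℝ}
    (hν : RegularTail ν β) (hβ : 1 < β) : 0 < mean ν := by
  have hfin := hν.lintegral_rpow_lt_top zero_le_one hβ
  simp_rw [Real.rpow_one] at hfin
  -- Without integrability the Bochner integral defining `mean` would default to 0.
  have hint : Integrable (fun x : ℝ≥0 => (x : ℝ)) ν := by
    refine ⟨by fun_prop, ?_⟩
    rw [hasFiniteIntegral_iff_ofReal (Eventually.of_forall fun x => x.2)]
    exact hfin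
  rw [mean, integral_pos_iff_support_of_nonneg (fun x => x.2) hint]
  have h0 := hν.pos 0
  rw [tail, measureReal_def] at h0
  refine (ENNReal.toReal_pos_iff.1 h0).1.trans_le (measure_mono fun x hx => ?_)
  exact (ne_of_gt hx : (x : ℝ) ≠ 0)

end ChungLu

theorem sameOrder_of_eventually {f g : ℕ → ℝ} {A B : ℝ} (hA : 0 < A)
    (hg : ∀ᶠ n in atTop, 0 ≤ g n) (hl : ∀ᶠ n in atTop, A * g n ≤ f n)
    (hu : ∀ᶠ n in atTop, f n ≤ B * g n) : SameOrder f g := by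
  obtain ⟨n₀, h⟩ := eventually_atTop.1 (hg.and (hl.and hu))
  refine ⟨n₀, A, max B (A + 1), hA, (lt_add_one A).trans_le (le_max_right _ _), fun n hn => ?_⟩
  obtain ⟨h0, h1, h2⟩ := h n hn.le
  exact ⟨h1, h2.trans (mul_le_mul_of_nonneg_right (le_max_left _ _) h0)⟩

/-! ### The two regimes -/

namespace ChungLu

open scoped ENNReal

theorem card_pairs {ι : Type*} [LinearOrder ι] (s : Finset ι) :
    ((pairs s).card : ℝ) = (s.card : ℝ) / 2 * (s.card - 1) := by
  have h := two_mul_sum_pairs s (fun _ _ => 1) fun _ _ => rfl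
  have h1 : ∑ e ∈ pairs s, Sym2.lift ⟨fun _ _ : ι => (1 : ℝ), fun _ _ => rfl⟩ e =
      (pairs s).card := by
    rw [Finset.card_eq_sum_ones, Nat.cast_sum]
    refine Finset.sum_congr rfl fun e _ => ?_
    induction e with
    | h i j => simp
  rw [h1] at h
  simp only [Finset.sum_const, nsmul_eq_mul, mul_one, Finset.offDiag_card] at h
  rw [Nat.cast_sub (Nat.le_mul_self _), Nat.cast_mul] at h
  linarith

theorem pairProb_eq_truncProd (ν : Measure ℝ≥0) (n : ℕ) (h : Fin n → ℝ≥0) (e : Sym2 (Fin n)) :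
    (pairProb ν n h e : ℝ) = truncProd (fun i => (h i : ℝ) / √(mean ν * n)) e := by
  induction e with
  | h i j =>
    rw [truncProd_mk, div_mul_div_comm,
      Real.mul_self_sqrt (mul_nonneg (mean_nonneg ν) n.cast_nonneg)]
    rfl

/-- Small cliques: the order of magnitude is that of the contribution of bounded weights. -/
theorem sameOrder_cliqueProb_of_lt {ν : Measure ℝ≥0} [IsProbabilityMeasure ν] {β : ℝ}
    (hν : RegularTail ν β) (hβ : 1 < β) {k : ℕ} (hk : 2 ≤ k) (hkβ : (k : ℝ) - 1 < β)
    {s : (n : ℕ) → Finset (Fin n)} (hs : ∀ n : ℕ, k ≤ n → (s n).card = k) :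
    SameOrder (fun n => cliqueProb ν n (s n)) (fun n => (n : ℝ) ^ ((k : ℝ) / 2 * (1 - (k : ℝ)))) := by
  have hμ := hν.mean_pos hβ
  have hk2 : (2 : ℝ) ≤ k := by exact_mod_cast hk
  have hfin := hν.lintegral_rpow_lt_top (p := (k : ℝ) - 1) (by linarith) hkβ
  set M := (∫⁻ x : ℝ≥0, ENNReal.ofReal ((x : ℝ) ^ ((k : ℝ) - 1)) ∂ν).toReal with hM
  have hMof : ∫⁻ x : ℝ≥0, ENNReal.ofReal ((x : ℝ) ^ ((k : ℝ) - 1)) ∂ν = ENNReal.ofReal M :=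
    (ENNReal.ofReal_toReal hfin.ne).symm
  have hM0 : 0 ≤ M := ENNReal.toReal_nonneg
  set γ : ℝ := (k : ℝ) / 2 * (1 - k) with hγ
  have hT := hν.pos 1
  refine sameOrder_of_eventually (A := mean ν ^ γ * tail ν 1 ^ k) (B := M ^ k * mean ν ^ γ)
    (by positivity) (Eventually.of_forall fun n => by positivity) ?_ ?_
  · obtain ⟨N, hN⟩ := exists_nat_ge (1 / mean ν)
    filter_upwards [eventually_ge_atTop N, eventually_ge_atTop k] with n hn hkn
    have hn0 : (0 : ℝ) < n := by exact_mod_cast (by omega : 0 < n)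
    have h1 := le_cliqueProb ν n (s n) 1 zero_le_one
    have hμn : 1 ≤ mean ν * n := by
      have : 1 / mean ν ≤ n := hN.trans (by exact_mod_cast hn)
      rwa [div_le_iff₀' hμ] at this
    rw [one_pow, min_eq_left (div_le_one_of_le₀ hμn (by positivity)), hs n hkn,
      ← Real.rpow_natCast, card_pairs, hs n hkn, one_div, Real.inv_rpow (by positivity),
      ← Real.rpow_neg (by positivity),
      show -((k : ℝ) / 2 * (k - 1)) = γ by rw [hγ]; ring, Real.mul_rpow hμ.le hn0.le] at h1
    refine le_trans (le_of_eq ?_) h1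
    rw [tail]; ring
  · filter_upwards [eventually_ge_atTop k] with n hkn
    have hn0 : (0 : ℝ) < n := by exact_mod_cast (by omega : 0 < n)
    have hμn : 0 < mean ν * n := by positivity
    have hq : 0 < √(mean ν * n) := Real.sqrt_pos.2 hμn
    have h1 := ofReal_cliqueProb_le ν n (s n)
      (f := fun x => ((x : ℝ) / √(mean ν * n)) ^ ((k : ℝ) - 1)) (by fun_prop)
      (fun x => Real.rpow_nonneg (div_nonneg x.2 hq.le) _) fun h => by
        simp_rw [pairProb_eq_truncProd]
        have := prod_pairs_min_le_prod_rpow (s n) (by rw [hs n hkn]; exact hk)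
          (fun i => (h i : ℝ) / √(mean ν * n)) fun i => div_nonneg (h i).2 hq.le
        rwa [hs n hkn] at this
    have h2 (x : ℝ≥0) : ENNReal.ofReal (((x : ℝ) / √(mean ν * n)) ^ ((k : ℝ) - 1)) =
        ENNReal.ofReal ((√(mean ν * n) ^ ((k : ℝ) - 1))⁻¹) *
          ENNReal.ofReal ((x : ℝ) ^ ((k : ℝ) - 1)) := by
      rw [← ENNReal.ofReal_mul (by positivity), Real.div_rpow x.coe_nonneg hq.le, div_eq_inv_mul]
    simp_rw [h2] at h1
    rw [lintegral_const_mul _ (by fun_prop), hMof, ← ENNReal.ofReal_mul (by positivity),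
      ← ENNReal.ofReal_pow (by positivity), ENNReal.ofReal_le_ofReal_iff (by positivity),
      hs n hkn, mul_pow] at h1
    refine h1.trans (le_of_eq ?_)
    have h3 : ((√(mean ν * n) ^ ((k : ℝ) - 1))⁻¹) ^ k = (mean ν * n) ^ γ := by
      rw [Real.sqrt_eq_rpow, ← Real.rpow_mul hμn.le, ← Real.rpow_neg hμn.le, ← Real.rpow_natCast,
        ← Real.rpow_mul hμn.le]
      congr 1
      rw [hγ]; ring
    rw [h3, Real.mul_rpow hμ.le hn0.le]
    ring

/-- Large cliques: the order of magnitude is that of the contribution of weights larger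
than `√(μ n)`. -/
theorem sameOrder_cliqueProb_of_gt {ν : Measure ℝ≥0} [IsProbabilityMeasure ν] {β : ℝ}
    (hν : RegularTail ν β) (hβ : 1 < β) {k : ℕ} (hkβ : β < (k : ℝ) - 1)
    {s : (n : ℕ) → Finset (Fin n)} (hs : ∀ n : ℕ, k ≤ n → (s n).card = k) :
    SameOrder (fun n => cliqueProb ν n (s n)) (fun n => tail ν √(n : ℝ) ^ k) := by
  have hμ := hν.mean_pos hβ
  have hk : 3 ≤ k := by
    have : (2 : ℝ) < k := by linarith
    exact_mod_cast this
  obtain ⟨c₀, hc₀, hprod⟩ := exists_prod_pairs_min_le k hk (by linarith : 0 < β) hkβ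
  -- The cap at `β` keeps the exponent `β - c` nonnegative.
  set c := min c₀ β with hc
  have hc0 : 0 < c := lt_min hc₀ (by linarith)
  obtain ⟨m₀, K, hm₀, hK, hint⟩ := hν.exists_lintegral_le hc0 (min_le_right _ _)
  set q := √(mean ν) ^ (-β) with hq
  have hq0 : 0 < q := Real.rpow_pos_of_pos (Real.sqrt_pos.2 hμ) _
  have hsqrt : Tendsto (fun n : ℕ => √(n : ℝ)) atTop atTop :=
    Real.tendsto_sqrt_atTop.comp tendsto_natCast_atTop_atTop
  -- The tails at `√(μ n)` and `√n` have a ratio tending to `q`, hence eventually between `q / 2`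
  -- and `2 * q`.
  have hratio := (hν.tendsto _ (Real.sqrt_pos.2 hμ)).comp hsqrt
  refine sameOrder_of_eventually (A := (q / 2) ^ k) (B := (K * (2 * q)) ^ k) (by positivity)
    (Eventually.of_forall fun n => pow_nonneg (tail_nonneg ν _) _) ?_ ?_
  · filter_upwards [hratio.eventually_const_lt (half_lt_self hq0), eventually_ge_atTop k]
      with n hn hkn
    have hn0 : (0 : ℝ) < n := by exact_mod_cast (by omega : 0 < n)
    have hμn : 0 < mean ν * n := by positivity
    have h1 := le_cliqueProb ν n (s n) √(mean ν * n) (Real.sqrt_nonneg _)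
    rw [Real.sq_sqrt hμn.le, div_self hμn.ne', min_self, one_pow, one_mul, hs n hkn] at h1
    refine le_trans ?_ h1
    rw [← mul_pow]
    refine pow_le_pow_left₀ (mul_nonneg (by positivity) (tail_nonneg ν _)) ?_ _
    rw [Function.comp_apply, lt_div_iff₀ (hν.pos _), ← Real.sqrt_mul hμ.le] at hn
    exact hn.le
  · filter_upwards [hratio.eventually_lt_const (by linarith : q < 2 * q), eventually_ge_atTop k,
      hsqrt.eventually_ge_atTop (m₀ / √(mean ν))] with n hn hkn hm
    have hn0 : (0 : ℝ) < n := by exact_mod_cast (by omega : 0 < n)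
    have hμn : 0 < mean ν * n := by positivity
    have hr : 0 < √(mean ν * n) := Real.sqrt_pos.2 hμn
    rw [Function.comp_apply, div_lt_iff₀ (hν.pos _), ← Real.sqrt_mul hμ.le] at hn
    rw [div_le_iff₀' (Real.sqrt_pos.2 hμ), ← Real.sqrt_mul hμ.le] at hm
    have hT := hν.pos √(mean ν * n)
    have h1 := ofReal_cliqueProb_le ν n (s n)
      (f := fun x => min (((x : ℝ) / √(mean ν * n)) ^ (β + c)) (((x : ℝ) / √(mean ν * n)) ^ (β - c)))
      (by fun_prop)
      (fun x => le_min (Real.rpow_nonneg (div_nonneg x.2 hr.le) _)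
        (Real.rpow_nonneg (div_nonneg x.2 hr.le) _)) fun h => by
        simp_rw [pairProb_eq_truncProd]
        exact hprod c hc0.le (min_le_left _ _) (s n) (hs n hkn)
          (fun i => (h i : ℝ) / √(mean ν * n)) fun i => div_nonneg (h i).2 hr.le
    have h2 := h1.trans (pow_le_pow_left' (hint _ hm) _)
    rw [← ENNReal.ofReal_pow (by positivity), ENNReal.ofReal_le_ofReal_iff (by positivity),
      hs n hkn] at h2
    refine h2.trans ?_
    rw [← mul_pow, mul_assoc K]
    gcongr

end ChungLu

theorem theorem1 (ν : Measure ℝ≥0) [IsProbabilityMeasure ν] (α : ℝ) (l : ℝ → ℝ)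
    (hα : 2 < α) (hαint : ∀ m : ℤ, α ≠ (m : ℝ))
    (hl : SlowlyVarying l)
    (htail : ∀ h : ℝ, 1 ≤ h → ν.real {x : ℝ≥0 | h < (x : ℝ)} = h ^ (1 - α) * l h)
    (k : ℕ) (hk : 2 ≤ k)
    (s : (n : ℕ) → Finset (Fin n)) (hs : ∀ n : ℕ, k ≤ n → (s n).card = k) :
    ((k : ℝ) < α →
      SameOrder (fun n => ChungLu.cliqueProb ν n (s n))
        (fun n => (n : ℝ) ^ ((k : ℝ) / 2 * (1 - (k : ℝ))))) ∧
    (α < (k : ℝ) →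
      SameOrder (fun n => ChungLu.cliqueProb ν n (s n))
        (fun n => (n : ℝ) ^ ((k : ℝ) / 2 * (1 - α)) * l (√(n : ℝ)) ^ k)) := by
  have hν : ChungLu.RegularTail ν (α - 1) := ChungLu.regularTail_of_slowlyVarying ν hl htail
  refine ⟨fun hkα => ChungLu.sameOrder_cliqueProb_of_lt hν (by linarith) hk (by linarith) hs,
    fun hkα => ?_⟩
  obtain ⟨n₀, C₁, C₂, hC₁, hC, h⟩ :=
    ChungLu.sameOrder_cliqueProb_of_gt hν (by linarith) (by linarith : α - 1 < (k : ℝ) - 1) hs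
  refine ⟨n₀, C₁, C₂, hC₁, hC, fun n hn => ?_⟩
  -- The tail formula is assumed only from 1 on, so it needs `√n ≥ 1`.
  have hn1 : (1 : ℝ) ≤ n := by exact_mod_cast (by omega : 1 ≤ n)
  have heq : (n : ℝ) ^ ((k : ℝ) / 2 * (1 - α)) * l (√(n : ℝ)) ^ k =
      ChungLu.tail ν √(n : ℝ) ^ k := by
    rw [ChungLu.tail, htail _ (Real.one_le_sqrt.2 hn1), mul_pow, Real.sqrt_eq_rpow,
      ← Real.rpow_mul n.cast_nonneg, ← Real.rpow_natCast ((n : ℝ) ^ _),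
      ← Real.rpow_mul n.cast_nonneg]
    congr 2
    ring
  simp only [heq]
  exact h n hn
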